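/- Consider an operational probabilistic theory with finite-dimensional state spaces (the size $D_A$ of a system $A$ is the dimension of the real span of its states), whose tests are finite and closed under coarse-graining. Assume strong causality (the choice of a test may depend on the outcome of a previous one) and regular scaling: for every system $A$ there is $k_A>0$ with $D_{A^{\boxtimes N}}\le k_A D_A^N$ for all $N\ge 1$. Let $B$ be an obit, i.e. a system such that for every system $X$ there are $k<\infty$ and deterministic $\mathcal C:X\to B^{\boxtimes k}$, $\mathcal F:B^{\boxtimes k}\to X$ with $\mathcal F\mathcal C=\mathcal I_X$. Let $D_1=D_B$, and let $\rho$ be a deterministic state of a system $A$; $\rho$ is called mixed if it is not pure, i.e. if it is the sum of some events of a preparation test that are not all multiples of $\rho$ with factors in $[0,1]$. For $\delta>0$ let $E^C_{N,M,\delta}(\rho)$ be the set of pairs of deterministic transformations $\mathcal E:A^{\boxtimes N}\to B^{\boxtimes M}$, $\mathcal D:B^{\boxtimes M}\to A^{\boxtimes N}$ with $$\sup_{C,\{\Psi_i\},\{a_j\}}\frac{|I(X:Y)-I(X:\tilde Y)|}{\log_2(mn-1)}<\delta .$$ Here $C$ ranges over all systems, $\{\Psi_i\}_{i=1}^n$ over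 the preparation tests of $A^{\boxtimes N}C$ such that discarding $C$ from $\sum_i\Psi_i$ by a deterministic effect gives $\rho^{\boxtimes N}$, and $\{a_j\}_{j=1}^m$ over the observation tests of $A^{\boxtimes N}C$; $I$ is the Shannon mutual information in bits, for $(X,Y)$ distributed as $(a_j|\Psi_i)$ and $(X,\tilde Y)$ as $(a_j|(\mathcal D\mathcal E\boxtimes\mathcal I_C)|\Psi_i)$. If $m=1$ or $n=1$, both mutual informations vanish and the quotient is read as $0$. The classical information content is $$I^C(\rho)=\lim_{\delta\to0^+}\ \limsup_{N\to\infty}\ \frac{\min\{M: E^C_{N,M,\delta}(\rho)\ne\emptyset\}}{N}\in[0,\infty].$$ Let $I(X_0:Y_0)$ be the maximal single-copy accessible mutual information of $\rho$: the supremum of the mutual information of the joint distribution $(a_j|\Psi_i)$ over the preparation tests $\{\Psi_i\}$ of $A$ with $\sum_i\Psi_i=\rho$ and the observation tests $\{a_j\}$ of $A$. Then $$I^C(\rho)\ \ge\ \frac{I(X_0:Y_0)}{\log_2 D_1}$$ (with $0/0=0$ and $x/0=\infty$ for $x>0$ if $D_1=1$), and if $\rho$ is mixed, then $I^C(\rho)>0$.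 -/

import Mathlib

open CategoryTheory MonoidalCategory Filter Topology
open scoped ENNReal

universe v u

/-- An operational probabilistic theory. Systems are the objects of a monoidal category, events are
its morphisms, sequential and parallel composition are `≫` and `⊗ₘ`, and the trivial system is
`𝟙_ C`. The monoidal category need not be strict: the structural isomorphisms, which are identities
in the strict case, are deterministic events. Tests are finite families of events, and every closed
circuit has a probability. -/
structure OPT (C : Type u) [Category.{v} C] [MonoidalCategory C] where
  /-- The finite families of events that are tests. -/
  IsTest : ∀ {A B : C} {ι : Type} [Fintype ι], (ι → (A ⟶ B)) → Prop
  /-- The probability of a closed circuit. -/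
  prob : (𝟙_ C ⟶ 𝟙_ C) → ℝ
  /-- Every event belongs to a test. -/
  exists_isTest : ∀ {A B : C} (f : A ⟶ B),
    ∃ (ι : Type) (_ : Fintype ι) (g : ι → (A ⟶ B)), IsTest g ∧ f ∈ Set.range g
  /-- The names of the outcomes are immaterial. -/
  isTest_relabel : ∀ {A B : C} {ι κ : Type} [Fintype ι] [Fintype κ] (r : κ ≃ ι)
    (f : ι → (A ⟶ B)), IsTest f → IsTest (fun k => f (r k))
  isTest_id : ∀ A : C, IsTest (fun _ : Unit => 𝟙 A)
  isTest_associator_hom : ∀ A B D : C, IsTest (fun _ : Unit => (α_ A B D).hom)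
  isTest_associator_inv : ∀ A B D : C, IsTest (fun _ : Unit => (α_ A B D).inv)
  isTest_leftUnitor_hom : ∀ A : C, IsTest (fun _ : Unit => (λ_ A).hom)
  isTest_leftUnitor_inv : ∀ A : C, IsTest (fun _ : Unit => (λ_ A).inv)
  isTest_rightUnitor_hom : ∀ A : C, IsTest (fun _ : Unit => (ρ_ A).hom)
  isTest_rightUnitor_inv : ∀ A : C, IsTest (fun _ : Unit => (ρ_ A).inv)
  /-- Sequential composition of tests. -/
  isTest_comp : ∀ {A B D : C} {ι κ : Type} [Fintype ι] [Fintype κ]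
    (f : ι → (A ⟶ B)) (g : κ → (B ⟶ D)), IsTest f → IsTest g →
      IsTest (fun x : ι × κ => f x.1 ≫ g x.2)
  /-- Parallel composition of tests. -/
  isTest_tensor : ∀ {A B A' B' : C} {ι κ : Type} [Fintype ι] [Fintype κ]
    (f : ι → (A ⟶ B)) (g : κ → (A' ⟶ B')), IsTest f → IsTest g →
      IsTest (fun x : ι × κ => f x.1 ⊗ₘ g x.2)
  /-- Coarse-graining: merging outcomes of a test along a surjection gives a test, whose events are
  operationally the sums of the merged events. -/
  exists_coarseGraining : ∀ {A B : C} {ι κ : Type} [Fintype ι] [Fintype κ] [DecidableEq κ]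
    (f : ι → (A ⟶ B)) (r : ι → κ), IsTest f → Function.Surjective r →
      ∃ g : κ → (A ⟶ B), IsTest g ∧
        ∀ (k : κ) (Z : C) (Ψ : 𝟙_ C ⟶ A ⊗ Z) (a : B ⊗ Z ⟶ 𝟙_ C),
          prob (Ψ ≫ (g k ▷ Z) ≫ a) =
            ∑ i ∈ Finset.univ.filter (fun i => r i = k), prob (Ψ ≫ (f i ▷ Z) ≫ a)
  prob_nonneg : ∀ f : 𝟙_ C ⟶ 𝟙_ C, 0 ≤ prob f
  /-- A test from the trivial system to itself is a probability distribution. -/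
  sum_prob : ∀ {ι : Type} [Fintype ι] (f : ι → (𝟙_ C ⟶ 𝟙_ C)), IsTest f → ∑ i, prob (f i) = 1
  /-- Compound tests from the trivial system to itself are independent. -/
  prob_comp : ∀ f g : 𝟙_ C ⟶ 𝟙_ C, prob (f ≫ g) = prob f * prob g

/-- Shannon mutual information, in bits, of a joint probability distribution. -/
noncomputable def mutualInfo {ι κ : Type} [Fintype ι] [Fintype κ] (p : ι → κ → ℝ) : ℝ :=
  ∑ i, ∑ j, p i j * Real.logb 2 (p i j / ((∑ j', p i j') * (∑ i', p i' j)))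

namespace OPT

variable {C : Type u} [Category.{v} C] [MonoidalCategory C] (T : OPT C)

/-- An event is deterministic if it is the unique event of a singleton test. -/
def IsDeterministic {A B : C} (f : A ⟶ B) : Prop := T.IsTest (fun _ : Unit => f)

/-- Operational equivalence of events: they induce the same transformation. -/
def OpEq {A B : C} (f g : A ⟶ B) : Prop :=
  ∀ (Z : C) (Ψ : 𝟙_ C ⟶ A ⊗ Z) (a : B ⊗ Z ⟶ 𝟙_ C),
    T.prob (Ψ ≫ (f ▷ Z) ≫ a) = T.prob (Ψ ≫ (g ▷ Z) ≫ a)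

/-- The state of a preparation event, as a functional on observation events. Two preparation
events define the same state exactly when these functionals agree. -/
def state {A : C} (σ : 𝟙_ C ⟶ A) : (A ⟶ 𝟙_ C) → ℝ := fun a => T.prob (σ ≫ a)

/-- The real linear span of the states of `A`. -/
def stateSpace (A : C) : Submodule ℝ ((A ⟶ 𝟙_ C) → ℝ) :=
  Submodule.span ℝ (Set.range (fun σ : 𝟙_ C ⟶ A => T.state σ))

/-- The size of a system: the dimension of the linear span of its states. -/
noncomputable def size (A : C) : ℕ := Module.finrank ℝ (T.stateSpace A)

/-- All the state spaces are finite-dimensional. -/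
def FiniteDimensionalStates : Prop := ∀ A : C, FiniteDimensional ℝ (T.stateSpace A)

/-- Strong causality: the test that is performed may depend on the outcome of an earlier test. -/
def StronglyCausal : Prop :=
  ∀ {A B D : C} {ι κ : Type} [Fintype ι] [Fintype κ] (f : ι → (A ⟶ B)) (g : ι → κ → (B ⟶ D)),
    T.IsTest f → (∀ i, T.IsTest (g i)) → T.IsTest (fun x : ι × κ => f x.1 ≫ g x.1 x.2)

/-- `N` copies of a system in parallel. -/
def copies (A : C) : ℕ → C
  | 0 => 𝟙_ C
  | N + 1 => copies A N ⊗ A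

/-- `N` copies of a preparation event in parallel. -/
def copiesState {A : C} (σ : 𝟙_ C ⟶ A) : (N : ℕ) → (𝟙_ C ⟶ copies A N)
  | 0 => 𝟙 (𝟙_ C)
  | N + 1 => (λ_ (𝟙_ C)).inv ≫ (copiesState σ N ⊗ₘ σ)

/-- Regular scaling: the size of `N` copies grows at most as the `N`-th power of the size of one
copy, up to a constant that depends on the system. -/
def RegularScaling : Prop :=
  ∀ A : C, ∃ k : ℝ, 0 < k ∧ ∀ N : ℕ, 1 ≤ N →
    (T.size (copies A N) : ℝ) ≤ k * (T.size A : ℝ) ^ N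

/-- `B` is an obit: every system can be encoded, deterministically and perfectly, in finitely many
copies of `B`. -/
def IsObit (B : C) : Prop :=
  ∀ X : C, ∃ (k : ℕ) (E : X ⟶ copies B k) (F : copies B k ⟶ X),
    T.IsDeterministic E ∧ T.IsDeterministic F ∧ T.OpEq (E ≫ F) (𝟙 X)

/-- A state is pure if it is atomic: whenever it is the sum of some of the events of a preparation
test, each of these events is a multiple of it, with factor in `[0, 1]`. -/
def IsPure {A : C} (σ : 𝟙_ C ⟶ A) : Prop :=
  ∀ (ι : Type) [Fintype ι] (f : ι → (𝟙_ C ⟶ A)) (Y : Finset ι), T.IsTest f →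
    T.state σ = ∑ i ∈ Y, T.state (f i) →
      ∀ i ∈ Y, ∃ c ∈ Set.Icc (0 : ℝ) 1, T.state (f i) = c • T.state σ

/-- A state is mixed if it is not pure. -/
def IsMixed {A : C} (σ : 𝟙_ C ⟶ A) : Prop := ¬ T.IsPure σ

/-- The events `Ψ i` on `A ⊗ Z` sum to a dilation of the state `σ` of `A`: discarding `Z` from their
sum with some deterministic effect gives `σ`. -/
def SumIsDilation {A Z : C} {ι : Type} [Fintype ι] (Ψ : ι → (𝟙_ C ⟶ A ⊗ Z)) (σ : 𝟙_ C ⟶ A) :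
    Prop :=
  ∃ e : Z ⟶ 𝟙_ C, T.IsDeterministic e ∧
    ∑ i, T.state (Ψ i ≫ (A ◁ e) ≫ (ρ_ A).hom) = T.state σ

/-- The joint distribution of the outcomes of a preparation test and of an observation test. -/
def joint {A : C} {ι κ : Type} (Ψ : ι → (𝟙_ C ⟶ A)) (a : κ → (A ⟶ 𝟙_ C)) : ι → κ → ℝ :=
  fun i j => T.prob (Ψ i ≫ a j)

/-- The supremum, over the ancillas `Z`, the preparation tests that sum to a dilation of `σ`, and
the observation tests on the system and the ancilla, of the normalized change of mutual information
caused by applying `f` to the system. If one of the tests has a single outcome, both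
mutual informations vanish, and so does the term. -/
noncomputable def infoDisturbance {A : C} (σ : 𝟙_ C ⟶ A) (f : A ⟶ A) : ℝ≥0∞ :=
  ⨆ (Z : C) (ι : Type) (κ : Type) (_ : Fintype ι) (_ : Fintype κ)
    (Ψ : ι → (𝟙_ C ⟶ A ⊗ Z)) (a : κ → (A ⊗ Z ⟶ 𝟙_ C))
    (_ : T.IsTest Ψ) (_ : T.SumIsDilation Ψ σ) (_ : T.IsTest a),
    ENNReal.ofReal
      ((Real.logb 2 ((Fintype.card κ : ℝ) * (Fintype.card ι : ℝ) - 1))⁻¹ *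
        |mutualInfo (T.joint Ψ a) - mutualInfo (T.joint (fun i => Ψ i ≫ (f ▷ Z)) a)|)

/-- The compression schemes from `N` copies of `A` to `M` copies of `B` that disturb the mutual
information by less than `δ`. -/
def schemes (B : C) {A : C} (σ : 𝟙_ C ⟶ A) (N M : ℕ) (δ : ℝ) :
    Set ((copies A N ⟶ copies B M) × (copies B M ⟶ copies A N)) :=
  {s | T.IsDeterministic s.1 ∧ T.IsDeterministic s.2 ∧
    T.infoDisturbance (copiesState σ N) (s.1 ≫ s.2) < ENNReal.ofReal δ}

/-- The smallest achievable compression ratio at length `N` and tolerance `δ`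
(it is `∞` if there is no scheme). -/
noncomputable def ratio (B : C) {A : C} (σ : 𝟙_ C ⟶ A) (δ : ℝ) (N : ℕ) : ℝ≥0∞ :=
  (⨅ (M : ℕ) (_ : (T.schemes B σ N M δ).Nonempty), (M : ℝ≥0∞)) / (N : ℝ≥0∞)

/-- The asymptotic compression ratio at tolerance `δ`. -/
noncomputable def asympRatio (B : C) {A : C} (σ : 𝟙_ C ⟶ A) (δ : ℝ) : ℝ≥0∞ :=
  limsup (fun N : ℕ => T.ratio B σ δ N) atTop

/-- The classical information content: the limit of the asymptotic compression ratio
as the tolerance tends to `0` from above. -/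
noncomputable def classInfoContent (B : C) {A : C} (σ : 𝟙_ C ⟶ A) : ℝ≥0∞ :=
  limUnder (𝓝[>] (0 : ℝ)) (fun δ => T.asympRatio B σ δ)

/-- The maximal accessible mutual information of a single copy: the supremum over the preparation
tests of `A` that sum to `σ` and over the observation tests of `A`. -/
noncomputable def accessibleInfo {A : C} (σ : 𝟙_ C ⟶ A) : ℝ≥0∞ :=
  ⨆ (ι : Type) (κ : Type) (_ : Fintype ι) (_ : Fintype κ)
    (Ψ : ι → (𝟙_ C ⟶ A)) (a : κ → (A ⟶ 𝟙_ C))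
    (_ : T.IsTest Ψ) (_ : ∑ i, T.state (Ψ i) = T.state σ) (_ : T.IsTest a),
    ENNReal.ofReal (mutualInfo (T.joint Ψ a))

theorem asympRatio_antitone (B : C) {A : C} (σ : 𝟙_ C ⟶ A) :
    Antitone (fun δ => T.asympRatio B σ δ) := by
  intro δ δ' h
  refine limsup_le_limsup (Eventually.of_forall fun N => ?_)
  refine ENNReal.div_le_div_right ?_ _
  refine iInf_mono fun M => ?_
  refine iInf_mono' fun hM => ⟨?_, le_rfl⟩
  obtain ⟨s, h1, h2, h3⟩ := hM
  exact ⟨s, h1, h2, lt_of_lt_of_le h3 (ENNReal.ofReal_le_ofReal h)⟩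

/-- The limit that defines the classical information content exists. -/
theorem tendsto_asympRatio (B : C) {A : C} (σ : 𝟙_ C ⟶ A) :
    Tendsto (fun δ => T.asympRatio B σ δ) (𝓝[>] (0 : ℝ)) (𝓝 (T.classInfoContent B σ)) :=
  tendsto_nhds_limUnder ⟨_, (T.asympRatio_antitone B σ).tendsto_nhdsGT 0⟩

end OPT

-- Data that pass through a system of size d carry at most log₂ d bits. States and effects pair
-- linearly, so a joint distribution p obtained there is a matrix of rank r ≤ d
-- (`rank_joint_le_size`). Divide its entries by the square roots of the marginals u, v to get M.
-- The eigenvalues of MMᵀ are at most 1, so its trace ∑ p²/(uv) is at most r, and concavity of the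
-- logarithm gives I ≤ log₂ r (`mutualInfo_le_logb_rank`).
--
-- Take single-copy tests with information I and L = log₂ of the number of outcome pairs, and repeat
-- them independently N times: the information becomes N·I, and the normalization of the disturbance
-- is at most N·L. A scheme with disturbance below δ sends nearly all of this through M copies of B,
-- so N·I ≤ c + M·log₂ D_B + δ·N·L, where c comes from regular scaling (`le_of_schemes_nonempty`).
-- Divide by N, let N → ∞, then δ → 0.
--
-- A mixed state has a decomposition with an event not proportional to it, and some effect sees this
-- as a correlation, so I > 0 (`accessibleInfo_pos`). Causality makes the marginal of the
-- preparation outcome independent of the observation test.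

section MutualInfo

-- Mutual information and rank of finite joint distributions.

variable {ι κ : Type} [Fintype ι] [Fintype κ]

/-- The operator norm of a nonnegative matrix normalized by its marginals is at most one. -/
theorem eigenvalue_le_one_of_normalized (p : ι → κ → ℝ) (hp : ∀ i j, 0 ≤ p i j)
    (M : Matrix ι κ ℝ)
    (hM : M = Matrix.of fun i j => p i j / (√(∑ j', p i j') * √(∑ i', p i' j)))
    {l : ℝ} {x : ι → ℝ} (hx : x ⬝ᵥ x = 1) (hl : (M * M.transpose).mulVec x = l • x) : l ≤ 1 := by
  set u : ι → ℝ := fun i => ∑ j', p i j' with hu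
  set v : κ → ℝ := fun j => ∑ i', p i' j with hv
  have hu0 : ∀ i, 0 ≤ u i := fun i => Finset.sum_nonneg fun j _ => hp i j
  have hv0 : ∀ j, 0 ≤ v j := fun j => Finset.sum_nonneg fun i _ => hp i j
  set y : κ → ℝ := M.transpose.mulVec x with hy
  have hxy : x ⬝ᵥ M.mulVec y = l := by
    rw [hy, Matrix.mulVec_mulVec, hl, dotProduct_smul, hx, smul_eq_mul, mul_one]
  have hyy : y ⬝ᵥ y = l := by
    rw [← hxy, Matrix.dotProduct_mulVec x, ← Matrix.mulVec_transpose]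
  -- Only an inequality: for a zero marginal the left side is 0.
  have hle : ∀ a b : ℝ, 0 ≤ a → a * (b ^ 2 / a) ≤ b ^ 2 := by
    intro a b ha
    rcases ha.eq_or_lt with rfl | ha
    · simpa using sq_nonneg b
    · rw [mul_div_cancel₀ _ ha.ne']
  -- The inequality 2st ≤ s² + t² with s = xᵢ/√uᵢ and t = yⱼ/√vⱼ, weighted by `p i j`.
  have hterm : ∀ i j, 2 * (x i * (M i j * y j)) ≤
      p i j * (x i ^ 2 / u i) + p i j * (y j ^ 2 / v j) := by
    intro i j
    have h1 : x i ^ 2 / u i = (x i / √(u i)) ^ 2 := by rw [div_pow, Real.sq_sqrt (hu0 i)]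
    have h2 : y j ^ 2 / v j = (y j / √(v j)) ^ 2 := by rw [div_pow, Real.sq_sqrt (hv0 j)]
    have h3 : x i * (M i j * y j) = p i j * ((x i / √(u i)) * (y j / √(v j))) := by
      rw [hM, Matrix.of_apply, div_mul_div_comm]
      ring
    rw [h1, h2, h3]
    nlinarith [mul_nonneg (hp i j) (sq_nonneg (x i / √(u i) - y j / √(v j)))]
  have hsum : 2 * (x ⬝ᵥ M.mulVec y) ≤ x ⬝ᵥ x + y ⬝ᵥ y := by
    calc 2 * (x ⬝ᵥ M.mulVec y) = ∑ i, ∑ j, 2 * (x i * (M i j * y j)) := by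
          simp only [dotProduct, Matrix.mulVec, Finset.mul_sum]
      _ ≤ ∑ i, ∑ j, (p i j * (x i ^ 2 / u i) + p i j * (y j ^ 2 / v j)) :=
          Finset.sum_le_sum fun i _ => Finset.sum_le_sum fun j _ => hterm i j
      _ = ∑ i, u i * (x i ^ 2 / u i) + ∑ j, v j * (y j ^ 2 / v j) := by
          simp only [Finset.sum_add_distrib]
          congr 1
          · simp only [hu, Finset.sum_mul]
          · rw [Finset.sum_comm]
            simp only [hv, Finset.sum_mul]
      _ ≤ ∑ i, x i ^ 2 + ∑ j, y j ^ 2 :=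
          add_le_add (Finset.sum_le_sum fun i _ => hle _ _ (hu0 i))
            (Finset.sum_le_sum fun j _ => hle _ _ (hv0 j))
      _ = x ⬝ᵥ x + y ⬝ᵥ y := by simp only [dotProduct, sq]
  -- Since y = Mᵀx, both xᵀMy and yᵀy equal l, and `hsum` becomes 2l ≤ 1 + l.
  rw [hxy, hx, hyy] at hsum
  linarith

/-- The squared Frobenius norm of the normalized matrix is at most its rank. -/
theorem sum_sq_div_marginals_le_rank (p : ι → κ → ℝ) (hp : ∀ i j, 0 ≤ p i j) :
    ∑ i, ∑ j, p i j ^ 2 / ((∑ j', p i j') * (∑ i', p i' j)) ≤ ((Matrix.of p).rank : ℝ) := by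
  classical
  set M : Matrix ι κ ℝ := Matrix.of fun i j => p i j / (√(∑ j', p i j') * √(∑ i', p i' j))
    with hM
  have hMdiag : M = Matrix.diagonal (fun i => (√(∑ j', p i j'))⁻¹) * Matrix.of p *
      Matrix.diagonal (fun j => (√(∑ i', p i' j))⁻¹) := by
    ext i j
    rw [Matrix.mul_diagonal, Matrix.diagonal_mul, hM, Matrix.of_apply, Matrix.of_apply,
      div_eq_mul_inv, mul_inv]
    ring
  have hrank : (M * M.transpose).rank ≤ (Matrix.of p).rank := by
    refine (Matrix.rank_mul_le_left _ _).trans ?_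
    rw [hMdiag]
    exact (Matrix.rank_mul_le_left _ _).trans (Matrix.rank_mul_le_right _ _)
  have hA : (M * M.transpose).IsHermitian := by
    have := Matrix.isHermitian_mul_conjTranspose_self M
    rwa [Matrix.conjTranspose_eq_transpose_of_trivial] at this
  have htr : (M * M.transpose).trace =
      ∑ i, ∑ j, p i j ^ 2 / ((∑ j', p i j') * (∑ i', p i' j)) := by
    simp only [Matrix.trace, Matrix.diag, Matrix.mul_apply, Matrix.transpose_apply, hM,
      Matrix.of_apply, ← sq, div_pow, mul_pow]
    refine Finset.sum_congr rfl fun i _ => Finset.sum_congr rfl fun j _ => ?_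
    rw [Real.sq_sqrt (Finset.sum_nonneg fun j _ => hp i j),
      Real.sq_sqrt (Finset.sum_nonneg fun i _ => hp i j)]
  have hev : ∀ i, hA.eigenvalues i ≤ 1 := by
    intro i
    refine eigenvalue_le_one_of_normalized p hp M hM (x := (hA.eigenvectorBasis i).ofLp) ?_
      (hA.mulVec_eigenvectorBasis i)
    have h := hA.eigenvectorBasis.orthonormal.1 i
    have h2 := EuclideanSpace.real_norm_sq_eq (hA.eigenvectorBasis i)
    rw [h] at h2
    simp only [dotProduct, ← sq]
    rw [← h2]
    norm_num
  rw [← htr, hA.trace_eq_sum_eigenvalues]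
  -- The rank of a Hermitian matrix counts its nonzero eigenvalues, each at most 1 here.
  calc ∑ i, ((hA.eigenvalues i : ℝ)) ≤ ∑ i, (if hA.eigenvalues i ≠ 0 then (1 : ℝ) else 0) := by
        refine Finset.sum_le_sum fun i _ => ?_
        split_ifs with h
        · exact hev i
        · exact (not_not.1 h).le
    _ = ((M * M.transpose).rank : ℝ) := by
        rw [hA.rank_eq_card_non_zero_eigs, Finset.sum_boole, Fintype.card_subtype]
    _ ≤ _ := by exact_mod_cast hrank

theorem le_sum_right {ι κ : Type} [Fintype κ] (p : ι → κ → ℝ) (hp : ∀ i j, 0 ≤ p i j)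
    (i : ι) (j : κ) : p i j ≤ ∑ j', p i j' :=
  Finset.single_le_sum (f := fun j' => p i j') (fun j' _ => hp i j') (Finset.mem_univ j)

theorem le_sum_left {ι κ : Type} [Fintype ι] (p : ι → κ → ℝ) (hp : ∀ i j, 0 ≤ p i j)
    (i : ι) (j : κ) : p i j ≤ ∑ i', p i' j :=
  Finset.single_le_sum (f := fun i' => p i' j) (fun i' _ => hp i' j) (Finset.mem_univ i)

theorem rank_pos_of_sum_eq_one (p : ι → κ → ℝ) (hs : ∑ i, ∑ j, p i j = 1) :
    0 < (Matrix.of p).rank := by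
  rw [Nat.pos_iff_ne_zero]
  intro h
  have h' : LinearMap.range (Matrix.of p).mulVecLin = ⊥ := Submodule.finrank_eq_zero.1 h
  classical
  have h0 : Matrix.of p = 0 := Matrix.toLin'.map_eq_zero_iff.1
    ((Matrix.toLin'_apply' _).trans (LinearMap.range_eq_bot.1 h'))
  have h1 : ∀ i j, p i j = 0 := fun i j => congrFun (congrFun h0 i) j
  simp [h1] at hs

/-- The mutual information is at most the logarithm of the rank of the joint distribution. -/
theorem mutualInfo_le_logb_rank (p : ι → κ → ℝ) (hp : ∀ i j, 0 ≤ p i j)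
    (hs : ∑ i, ∑ j, p i j = 1) : mutualInfo p ≤ Real.logb 2 ((Matrix.of p).rank : ℝ) := by
  set r : ℝ := ((Matrix.of p).rank : ℝ) with hr
  have hr0 : 0 < r := Nat.cast_pos.2 (rank_pos_of_sum_eq_one p hs)
  have hlog2 : 0 < Real.log 2 := Real.log_pos one_lt_two
  -- The tangent to the logarithm at r: log x ≤ x/r − 1 + log r. Averaged over p, the x/r terms add
  -- up to at most 1 and log r remains.
  have hterm : ∀ i j, p i j * Real.log (p i j / ((∑ j', p i j') * (∑ i', p i' j))) ≤
      p i j ^ 2 / ((∑ j', p i j') * (∑ i', p i' j)) / r + p i j * (Real.log r - 1) := by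
    intro i j
    rcases (hp i j).eq_or_lt with h | h
    · simp [← h]
    · have hu : 0 < ∑ j', p i j' := h.trans_le (le_sum_right p hp i j)
      have hv : 0 < ∑ i', p i' j := h.trans_le (le_sum_left p hp i j)
      set x := p i j / ((∑ j', p i j') * (∑ i', p i' j)) with hx
      have hx0 : 0 < x := by positivity
      have h1 := Real.log_le_sub_one_of_pos (div_pos hx0 hr0)
      rw [Real.log_div hx0.ne' hr0.ne'] at h1
      have h2 : p i j ^ 2 / ((∑ j', p i j') * (∑ i', p i' j)) / r = p i j * (x / r) := by
        rw [hx]; ring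
      rw [h2, ← mul_add]
      exact mul_le_mul_of_nonneg_left (by linarith) h.le
  have hsum : ∑ i, ∑ j, p i j * Real.log (p i j / ((∑ j', p i j') * (∑ i', p i' j))) ≤
      Real.log r := by
    refine (Finset.sum_le_sum fun i _ => Finset.sum_le_sum fun j _ => hterm i j).trans ?_
    simp only [Finset.sum_add_distrib, ← Finset.sum_mul, ← Finset.sum_div, hs, one_mul]
    have := (div_le_one hr0).2 (sum_sq_div_marginals_le_rank p hp)
    linarith
  have hmi : mutualInfo p =
      (∑ i, ∑ j, p i j * Real.log (p i j / ((∑ j', p i j') * (∑ i', p i' j)))) / Real.log 2 := by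
    simp only [mutualInfo, Real.logb, Finset.sum_div, mul_div_assoc]
  rw [hmi, Real.logb]
  exact div_le_div_of_nonneg_right hsum hlog2.le

/-- The mutual information is positive unless the outcomes are independent. -/
theorem mutualInfo_pos (p : ι → κ → ℝ) (hp : ∀ i j, 0 ≤ p i j) (hs : ∑ i, ∑ j, p i j = 1)
    {i₀ : ι} {j₀ : κ} (h₀ : p i₀ j₀ ≠ (∑ j', p i₀ j') * (∑ i', p i' j₀)) : 0 < mutualInfo p := by
  have hlog2 : 0 < Real.log 2 := Real.log_pos one_lt_two
  set q : ι → κ → ℝ := fun i j => (∑ j', p i j') * (∑ i', p i' j) with hq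
  have hq0 : ∀ i j, 0 ≤ q i j := fun i j => mul_nonneg
    (Finset.sum_nonneg fun j _ => hp i j) (Finset.sum_nonneg fun i _ => hp i j)
  have hlt : ∀ i j, p i j ≠ q i j → p i j - q i j < p i j * Real.log (p i j / q i j) := by
    intro i j hne
    rcases (hp i j).eq_or_lt with h | h
    · rw [← h] at hne ⊢
      have := lt_of_le_of_ne (hq0 i j) hne
      simpa using this
    · have hqp : 0 < q i j := mul_pos (h.trans_le (le_sum_right p hp i j))
        (h.trans_le (le_sum_left p hp i j))
      have h1 := Real.log_lt_sub_one_of_pos (div_pos hqp h)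
        (fun h' => hne ((div_eq_one_iff_eq h.ne').1 h').symm)
      rw [← inv_div, Real.log_inv] at h1
      have h2 := mul_lt_mul_of_pos_left h1 h
      have h3 : p i j * ((p i j / q i j)⁻¹ - 1) = q i j - p i j := by
        rw [inv_div]; field_simp
      rw [h3] at h2
      linarith
  have hle : ∀ i j, p i j - q i j ≤ p i j * Real.log (p i j / q i j) := by
    intro i j
    rcases eq_or_ne (p i j) (q i j) with h | h
    · rw [h]
      rcases eq_or_ne (q i j) 0 with h' | h'
      · simp [h']
      · simp [div_self h']
    · exact (hlt i j h).le
  -- Both p and the product of its marginals have mass 1, so the termwise lower bounds cancel and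
  -- one strict term suffices.
  have hzero : ∑ i, ∑ j, (p i j - q i j) = 0 := by
    simp only [Finset.sum_sub_distrib, hq, ← Finset.mul_sum, ← Finset.sum_mul]
    rw [Finset.sum_comm (f := fun j i => p i j), hs]
    norm_num
  have hpos : 0 < ∑ i, ∑ j, p i j * Real.log (p i j / q i j) := by
    rw [← hzero]
    refine Finset.sum_lt_sum (fun i _ => Finset.sum_le_sum fun j _ => hle i j)
      ⟨i₀, Finset.mem_univ _, ?_⟩
    exact Finset.sum_lt_sum (fun j _ => hle i₀ j) ⟨j₀, Finset.mem_univ _, hlt i₀ j₀ h₀⟩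
  have hmi : mutualInfo p = (∑ i, ∑ j, p i j * Real.log (p i j / q i j)) / Real.log 2 := by
    simp only [mutualInfo, Real.logb, Finset.sum_div, mul_div_assoc, hq]
  rw [hmi]
  exact div_pos hpos hlog2

/-- The mutual information of independent pairs is additive. -/
theorem mutualInfo_prod {ι' κ' : Type} [Fintype ι'] [Fintype κ'] (p : ι → κ → ℝ)
    (hp : ∀ i j, 0 ≤ p i j) (hs : ∑ i, ∑ j, p i j = 1) (q : ι' → κ' → ℝ)
    (hq : ∀ i j, 0 ≤ q i j) (hs' : ∑ i, ∑ j, q i j = 1) :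
    mutualInfo (fun (i : ι × ι') (j : κ × κ') => p i.1 j.1 * q i.2 j.2) =
      mutualInfo p + mutualInfo q := by
  have hterm : ∀ i j i' j', p i j * q i' j' * Real.logb 2 (p i j * q i' j' /
      (((∑ j', p i j') * ∑ j, q i' j) * ((∑ i', p i' j) * ∑ i, q i j'))) =
      p i j * Real.logb 2 (p i j / ((∑ j', p i j') * (∑ i', p i' j))) * q i' j' +
      p i j * (q i' j' * Real.logb 2 (q i' j' / ((∑ j, q i' j) * (∑ i, q i j')))) := by
    intro i j i' j'
    rcases (hp i j).eq_or_lt with h | h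
    · simp [← h]
    rcases (hq i' j').eq_or_lt with h' | h'
    · simp [← h']
    have h1 := h.trans_le (le_sum_right p hp i j)
    have h2 := h.trans_le (le_sum_left p hp i j)
    have h3 := h'.trans_le (le_sum_right q hq i' j')
    have h4 := h'.trans_le (le_sum_left q hq i' j')
    rw [mul_mul_mul_comm, ← div_mul_div_comm, Real.logb_mul (by positivity) (by positivity)]
    ring
  have hsum : ∀ i i', ∑ x : κ × κ', p i x.1 * q i' x.2 = (∑ j', p i j') * ∑ j, q i' j := by
    intro i i'
    rw [Fintype.sum_prod_type, Finset.sum_mul_sum]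
  have hsum' : ∀ j j', ∑ x : ι × ι', p x.1 j * q x.2 j' = (∑ i', p i' j) * ∑ i, q i j' := by
    intro i i'
    rw [Fintype.sum_prod_type, Finset.sum_mul_sum]
  simp only [mutualInfo, hsum, hsum', hterm]
  simp only [Fintype.sum_prod_type, Finset.sum_add_distrib, ← Finset.mul_sum, ← Finset.sum_mul,
    hs, hs', mul_one, one_mul]

end MutualInfo

-- Tests and causality.

namespace OPT

variable {C : Type u} [Category.{v} C] [MonoidalCategory C] (T : OPT C)

variable {T} in
theorem IsTest.comp_deterministic {A B D : C} {ι : Type} [Fintype ι] {f : ι → (A ⟶ B)}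
    (hf : T.IsTest f) {g : B ⟶ D} (hg : T.IsDeterministic g) : T.IsTest (fun i => f i ≫ g) :=
  T.isTest_relabel (Equiv.prodPUnit ι).symm _ (T.isTest_comp f (fun _ : Unit => g) hf hg)

variable {T} in
theorem IsDeterministic.comp_isTest {A B D : C} {κ : Type} [Fintype κ] {f : A ⟶ B}
    (hf : T.IsDeterministic f) {g : κ → (B ⟶ D)} (hg : T.IsTest g) :
    T.IsTest (fun k => f ≫ g k) :=
  T.isTest_relabel (Equiv.punitProd κ).symm _ (T.isTest_comp (fun _ : Unit => f) g hf hg)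

/-- The joint distribution of a preparation test and of an observation test is normalized. -/
theorem sum_joint {A : C} {ι κ : Type} [Fintype ι] [Fintype κ] {Ψ : ι → (𝟙_ C ⟶ A)}
    {a : κ → (A ⟶ 𝟙_ C)} (hΨ : T.IsTest Ψ) (ha : T.IsTest a) :
    ∑ i, ∑ j, T.joint Ψ a i j = 1 := by
  have h := T.sum_prob _ (T.isTest_comp Ψ a hΨ ha)
  rwa [Fintype.sum_prod_type] at h

theorem joint_nonneg {A : C} {ι κ : Type} (Ψ : ι → (𝟙_ C ⟶ A)) (a : κ → (A ⟶ 𝟙_ C)) (i : ι)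
    (j : κ) : 0 ≤ T.joint Ψ a i j := T.prob_nonneg _

/-- The total of an observation test: a deterministic effect that sums its events. -/
theorem exists_deterministic_effect {A : C} {κ : Type} [Fintype κ] [Nonempty κ]
    {a : κ → (A ⟶ 𝟙_ C)} (ha : T.IsTest a) :
    ∃ e : A ⟶ 𝟙_ C, T.IsDeterministic e ∧
      ∀ σ : 𝟙_ C ⟶ A, T.prob (σ ≫ e) = ∑ j, T.prob (σ ≫ a j) := by
  obtain ⟨g, hg, hsum⟩ := T.exists_coarseGraining a (fun _ : κ => ()) ha
    (fun _ => ⟨Classical.arbitrary κ, rfl⟩)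
  refine ⟨g (), hg, fun σ => ?_⟩
  have h := hsum () (𝟙_ C) (σ ≫ (ρ_ A).inv) ((ρ_ (𝟙_ C)).hom ≫ 𝟙 _)
  simpa using h

/-- Causality: deterministic effects agree on the events of preparation tests. -/
theorem prob_deterministic_effect_eq (hcausal : T.StronglyCausal) {A : C} {ι : Type} [Fintype ι]
    {Ψ : ι → (𝟙_ C ⟶ A)} (hΨ : T.IsTest Ψ) {e e' : A ⟶ 𝟙_ C} (he : T.IsDeterministic e)
    (he' : T.IsDeterministic e') (i : ι) : T.prob (Ψ i ≫ e) = T.prob (Ψ i ≫ e') := by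
  classical
  -- Apply `e` after outcome `i` and `e'` after any other. This test and the one that always applies
  -- `e'` both have total 1 and differ only in the term `i`.
  have h1 := T.sum_prob _ (hcausal Ψ (fun k (_ : Unit) => if k = i then e else e') hΨ
    (fun k => by split_ifs <;> assumption))
  have h2 := T.sum_prob _ (IsTest.comp_deterministic hΨ he')
  rw [Fintype.sum_prod_type] at h1
  simp only [Finset.univ_unique, Finset.sum_singleton] at h1
  rw [← Finset.add_sum_erase _ _ (Finset.mem_univ i)] at h1 h2
  rw [Finset.sum_congr rfl (g := fun k => T.prob (Ψ k ≫ e'))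
    (fun k hk => by rw [if_neg (Finset.ne_of_mem_erase hk)]), if_pos rfl] at h1
  linarith

theorem sum_prob_eq_of_sum_state_eq {A : C} {ι : Type} [Fintype ι] {Ψ : ι → (𝟙_ C ⟶ A)}
    {σ : 𝟙_ C ⟶ A} (h : ∑ i, T.state (Ψ i) = T.state σ) (a : A ⟶ 𝟙_ C) :
    ∑ i, T.prob (Ψ i ≫ a) = T.prob (σ ≫ a) := by
  have := congrFun h a
  rwa [Finset.sum_apply] at this

theorem nonempty_of_isTest {A : C} {ι κ : Type} [Fintype ι] [Fintype κ] {Ψ : ι → (𝟙_ C ⟶ A)}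
    {a : κ → (A ⟶ 𝟙_ C)} (hΨ : T.IsTest Ψ) (ha : T.IsTest a) : Nonempty κ := by
  by_contra h
  rw [not_nonempty_iff] at h
  simpa using T.sum_joint hΨ ha

-- Mixed states.

/-- A mixed deterministic state has positive accessible information. -/
theorem accessibleInfo_pos (hcausal : T.StronglyCausal) {A : C} {σ : 𝟙_ C ⟶ A}
    (hσ : T.IsDeterministic σ) (hmix : T.IsMixed σ) : 0 < T.accessibleInfo σ := by
  classical
  unfold IsMixed IsPure at hmix
  push Not at hmix
  obtain ⟨ι, _, f, Y, hf, hsum, i₀, hi₀, hne⟩ := hmix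
  -- Without effects all states coincide, and the factor 0 would already work.
  obtain ⟨a₀⟩ : Nonempty (A ⟶ 𝟙_ C) := by
    by_contra h
    rw [not_nonempty_iff] at h
    exact hne 0 ⟨le_rfl, zero_le_one⟩ (funext fun a => isEmptyElim a)
  obtain ⟨κ₀, _, b, hb, -⟩ := T.exists_isTest a₀
  have := T.nonempty_of_isTest hσ hb
  obtain ⟨e, he, -⟩ := T.exists_deterministic_effect hb
  have htot : ∑ i, T.prob (f i ≫ e) = 1 := T.sum_prob _ (IsTest.comp_deterministic hf he)
  have hσe : T.prob (σ ≫ e) = 1 := by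
    simpa using T.sum_prob _ (IsTest.comp_deterministic hσ he)
  have hY : ∑ i ∈ Y, T.prob (f i ≫ e) = 1 := by
    have h := congrFun hsum e
    rw [Finset.sum_apply] at h
    exact h.symm.trans hσe
  -- The events in `Y` already exhaust probability 1, so the others vanish and the whole test sums
  -- to `σ`.
  have hout : ∀ i ∉ Y, T.prob (f i ≫ e) = 0 := by
    intro i hi
    have h1 : ∑ i ∈ insert i Y, T.prob (f i ≫ e) ≤ ∑ i, T.prob (f i ≫ e) :=
      Finset.sum_le_univ_sum_of_nonneg fun i => T.prob_nonneg _
    rw [Finset.sum_insert hi, hY, htot] at h1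
    exact le_antisymm (by linarith) (T.prob_nonneg _)
  have hmarg : ∀ {κ : Type} [Fintype κ] {a : κ → (A ⟶ 𝟙_ C)}, T.IsTest a → ∀ i,
      ∑ j, T.prob (f i ≫ a j) = T.prob (f i ≫ e) := by
    intro κ _ a ha i
    have := T.nonempty_of_isTest hσ ha
    obtain ⟨e', he', hsum'⟩ := T.exists_deterministic_effect ha
    rw [← hsum', T.prob_deterministic_effect_eq hcausal hf he he' i]
  have hfsum : ∑ i, T.state (f i) = T.state σ := by
    rw [hsum]
    symm
    refine Finset.sum_subset (Finset.subset_univ Y) fun i _ hi => funext fun a => ?_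
    obtain ⟨κ, _, a', ha', j, rfl⟩ := T.exists_isTest a
    have h := Finset.single_le_sum (f := fun j => T.prob (f i ≫ a' j))
      (fun j _ => T.prob_nonneg _) (Finset.mem_univ j)
    rw [hmarg ha' i, hout i hi] at h
    exact le_antisymm h (T.prob_nonneg _)
  -- With the probability of `i₀` as the factor, failure of proportionality on an effect is exactly
  -- failure of independence.
  have hc : T.prob (f i₀ ≫ e) ∈ Set.Icc (0 : ℝ) 1 := by
    refine ⟨T.prob_nonneg _, ?_⟩
    rw [← htot]
    exact Finset.single_le_sum (f := fun i => T.prob (f i ≫ e))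
      (fun i _ => T.prob_nonneg _) (Finset.mem_univ i₀)
  obtain ⟨a, ha⟩ := Function.ne_iff.1 (hne _ hc)
  obtain ⟨κ, _, a', ha', j, rfl⟩ := T.exists_isTest a
  have hpos : 0 < mutualInfo (T.joint f a') := by
    refine mutualInfo_pos _ (T.joint_nonneg f a') (T.sum_joint hf ha') (i₀ := i₀) (j₀ := j) ?_
    simp only [joint, hmarg ha', T.sum_prob_eq_of_sum_state_eq hfsum]
    exact ha
  unfold accessibleInfo
  simp only [lt_iSup_iff]
  exact ⟨ι, κ, inferInstance, inferInstance, f, a', hf, hfsum, ha', ENNReal.ofReal_pos.2 hpos⟩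

-- Information capacity of a system.

/-- The size of the trivial system is at most one. -/
theorem size_unit_le : T.size (𝟙_ C) ≤ 1 := by
  have h : T.stateSpace (𝟙_ C) ≤ Submodule.span ℝ {fun a : 𝟙_ C ⟶ 𝟙_ C => T.prob a} := by
    refine Submodule.span_le.2 ?_
    rintro _ ⟨σ, rfl⟩
    refine Submodule.mem_span_singleton.2 ⟨T.prob σ, funext fun a => ?_⟩
    exact (T.prob_comp σ a).symm
  refine (Submodule.finrank_mono h).trans ?_
  exact (finrank_span_le_card _).trans (by simp)

/-- The joint distributions of states and effects of a system have rank at most its size. -/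
theorem rank_joint_le_size (hfin : T.FiniteDimensionalStates) {X : C} {ι κ : Type} [Fintype ι]
    [Fintype κ] (Ψ : ι → (𝟙_ C ⟶ X)) (a : κ → (X ⟶ 𝟙_ C)) :
    (Matrix.of (T.joint Ψ a)).rank ≤ T.size X := by
  have := hfin X
  -- Evaluation on the effects `a` is linear on the state space, and its range contains every row of
  -- the joint matrix.
  set L : T.stateSpace X →ₗ[ℝ] (κ → ℝ) :=
    (LinearMap.funLeft ℝ ℝ a).comp (T.stateSpace X).subtype with hL
  rw [Matrix.rank_eq_finrank_span_row]
  have hle : Submodule.span ℝ (Set.range (Matrix.of (T.joint Ψ a)).row) ≤ LinearMap.range L := by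
    refine Submodule.span_le.2 ?_
    rintro _ ⟨i, rfl⟩
    exact ⟨⟨T.state (Ψ i), Submodule.subset_span ⟨Ψ i, rfl⟩⟩, rfl⟩
  exact (Submodule.finrank_mono hle).trans (LinearMap.finrank_range_le L)

/-- The mutual information carried by a system is at most the logarithm of its size. -/
theorem mutualInfo_joint_le (hfin : T.FiniteDimensionalStates) {X : C} {ι κ : Type} [Fintype ι]
    [Fintype κ] {Ψ : ι → (𝟙_ C ⟶ X)} {a : κ → (X ⟶ 𝟙_ C)} (hΨ : T.IsTest Ψ)
    (ha : T.IsTest a) : 1 ≤ T.size X ∧ mutualInfo (T.joint Ψ a) ≤ Real.logb 2 (T.size X) := by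
  have h1 : 1 ≤ (Matrix.of (T.joint Ψ a)).rank := rank_pos_of_sum_eq_one _ (T.sum_joint hΨ ha)
  have h2 := T.rank_joint_le_size hfin Ψ a
  refine ⟨h1.trans h2, (mutualInfo_le_logb_rank _ (T.joint_nonneg Ψ a) (T.sum_joint hΨ ha)).trans ?_⟩
  exact Real.logb_le_logb_of_le one_lt_two (by exact_mod_cast h1) (by exact_mod_cast h2)

-- Independent copies.

theorem prob_tensor {A B : C} (σ : 𝟙_ C ⟶ A) (τ : 𝟙_ C ⟶ B) (a : A ⟶ 𝟙_ C) (b : B ⟶ 𝟙_ C) :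
    T.prob (((λ_ (𝟙_ C)).inv ≫ (σ ⊗ₘ τ)) ≫ (a ⊗ₘ b) ≫ (λ_ (𝟙_ C)).hom) =
      T.prob (σ ≫ a) * T.prob (τ ≫ b) := by
  rw [← T.prob_comp]
  congr 1
  rw [Category.assoc, tensorHom_comp_tensorHom_assoc, MonoidalCategory.tensorHom_def]
  simp [unitors_equal, unitors_inv_equal]

/-- A joint effect with one factor's preparation plugged in is an effect on the other factor, so the
two sums can be evaluated one factor at a time. -/
theorem sum_state_tensor {A B : C} {ι κ : Type} [Fintype ι] [Fintype κ] {Ψ : ι → (𝟙_ C ⟶ A)}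
    {Φ : κ → (𝟙_ C ⟶ B)} {σ : 𝟙_ C ⟶ A} {τ : 𝟙_ C ⟶ B} (hΨ : ∑ i, T.state (Ψ i) = T.state σ)
    (hΦ : ∑ i, T.state (Φ i) = T.state τ) :
    ∑ x : ι × κ, T.state ((λ_ (𝟙_ C)).inv ≫ (Ψ x.1 ⊗ₘ Φ x.2)) =
      T.state ((λ_ (𝟙_ C)).inv ≫ (σ ⊗ₘ τ)) := by
  have hl : ∀ (μ : 𝟙_ C ⟶ A) (ν : 𝟙_ C ⟶ B) (a : A ⊗ B ⟶ 𝟙_ C),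
      ((λ_ (𝟙_ C)).inv ≫ (μ ⊗ₘ ν)) ≫ a = μ ≫ (ρ_ A).inv ≫ (A ◁ ν) ≫ a := by
    intro μ ν a
    rw [MonoidalCategory.tensorHom_def]
    simp [unitors_inv_equal]
  have hr : ∀ (μ : 𝟙_ C ⟶ A) (ν : 𝟙_ C ⟶ B) (a : A ⊗ B ⟶ 𝟙_ C),
      ((λ_ (𝟙_ C)).inv ≫ (μ ⊗ₘ ν)) ≫ a = ν ≫ (λ_ B).inv ≫ (μ ▷ B) ≫ a := by
    intro μ ν a
    rw [MonoidalCategory.tensorHom_def']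
    simp
  funext a
  rw [Finset.sum_apply, Fintype.sum_prod_type]
  simp only [state]
  calc ∑ i, ∑ j, T.prob (((λ_ (𝟙_ C)).inv ≫ (Ψ i ⊗ₘ Φ j)) ≫ a)
      = ∑ i, T.prob (((λ_ (𝟙_ C)).inv ≫ (Ψ i ⊗ₘ τ)) ≫ a) := by
        refine Finset.sum_congr rfl fun i _ => ?_
        simp only [hr]
        exact T.sum_prob_eq_of_sum_state_eq hΦ _
    _ = _ := by
        simp only [hl]
        exact T.sum_prob_eq_of_sum_state_eq hΨ _

/-- Independent repetitions of a preparation test and of an observation test. -/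
theorem exists_copies_tests {A : C} {σ : 𝟙_ C ⟶ A} {ι κ : Type} [Fintype ι] [Fintype κ]
    {Ψ : ι → (𝟙_ C ⟶ A)} {a : κ → (A ⟶ 𝟙_ C)} (hΨ : T.IsTest Ψ)
    (hσ : ∑ i, T.state (Ψ i) = T.state σ) (ha : T.IsTest a) (N : ℕ) :
    ∃ (ι' κ' : Type) (_ : Fintype ι') (_ : Fintype κ') (Ψ' : ι' → (𝟙_ C ⟶ copies A N))
      (a' : κ' → (copies A N ⟶ 𝟙_ C)), T.IsTest Ψ' ∧
      ∑ i, T.state (Ψ' i) = T.state (copiesState σ N) ∧ T.IsTest a' ∧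
      Fintype.card ι' = Fintype.card ι ^ N ∧ Fintype.card κ' = Fintype.card κ ^ N ∧
      mutualInfo (T.joint Ψ' a') = N * mutualInfo (T.joint Ψ a) := by
  induction N with
  | zero =>
    refine ⟨Unit, Unit, inferInstance, inferInstance, fun _ => 𝟙 _, fun _ => 𝟙 _,
      T.isTest_id _, by simp [copiesState], T.isTest_id _, by simp, by simp, ?_⟩
    have h1 : T.prob (𝟙 (𝟙_ C)) = 1 := by simpa using T.sum_prob _ (T.isTest_id (𝟙_ C))
    have h2 : T.joint (fun _ : Unit => 𝟙 (𝟙_ C)) (fun _ : Unit => 𝟙 (𝟙_ C)) = fun _ _ => 1 := by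
      funext i j
      simp [joint, h1]
    refine (congrArg mutualInfo h2).trans ?_
    simp [mutualInfo]
  | succ N ih =>
    obtain ⟨ι', κ', _, _, Ψ', a', hΨ', hσ', ha', hι, hκ, hI⟩ := ih
    refine ⟨ι' × ι, κ' × κ, inferInstance, inferInstance,
      fun x => (λ_ (𝟙_ C)).inv ≫ (Ψ' x.1 ⊗ₘ Ψ x.2), fun x => (a' x.1 ⊗ₘ a x.2) ≫ (λ_ (𝟙_ C)).hom,
      IsDeterministic.comp_isTest (T.isTest_leftUnitor_inv _) (T.isTest_tensor _ _ hΨ' hΨ),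
      T.sum_state_tensor hσ' hσ,
      IsTest.comp_deterministic (T.isTest_tensor _ _ ha' ha) (T.isTest_leftUnitor_hom _),
      by rw [Fintype.card_prod, hι, pow_succ], by rw [Fintype.card_prod, hκ, pow_succ], ?_⟩
    have h := mutualInfo_prod _ (T.joint_nonneg Ψ' a') (T.sum_joint hΨ' ha') _
      (T.joint_nonneg Ψ a) (T.sum_joint hΨ ha)
    rw [hI] at h
    have hj : T.joint (fun x : ι' × ι => (λ_ (𝟙_ C)).inv ≫ (Ψ' x.1 ⊗ₘ Ψ x.2))
        (fun x : κ' × κ => (a' x.1 ⊗ₘ a x.2) ≫ (λ_ (𝟙_ C)).hom) =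
        fun i j => T.joint Ψ' a' i.1 j.1 * T.joint Ψ a i.2 j.2 := by
      funext i j
      exact T.prob_tensor _ _ _ _
    refine (congrArg mutualInfo hj).trans (h.trans ?_)
    push_cast
    ring

-- Lower bound on the compression ratio.

/-- Regular scaling in logarithmic form. -/
theorem exists_logb_size_copies_le (hscaling : T.RegularScaling) (B : C) :
    ∃ c : ℝ, ∀ M : ℕ, 1 ≤ T.size (copies B M) →
      Real.logb 2 (T.size (copies B M)) ≤ c + M * Real.logb 2 (T.size B) := by
  obtain ⟨k, hk, hle⟩ := hscaling B
  refine ⟨Real.logb 2 (max k 1), fun M hM => ?_⟩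
  -- Harmless for size 0, because `Real.logb 2 0 = 0`.
  have hD : Real.logb 2 (T.size B : ℝ) = Real.logb 2 (max (T.size B : ℝ) 1) := by
    rcases Nat.eq_zero_or_pos (T.size B) with h | h
    · simp [h]
    · rw [max_eq_left (by exact_mod_cast h)]
  have h1 : (T.size (copies B M) : ℝ) ≤ max k 1 * max (T.size B : ℝ) 1 ^ M := by
    rcases Nat.eq_zero_or_pos M with rfl | h
    · have : (T.size (copies B 0) : ℝ) ≤ 1 := by exact_mod_cast T.size_unit_le
      simpa using Or.inr this
    · exact (hle M h).trans (mul_le_mul (le_max_left _ _)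
        (pow_le_pow_left₀ (Nat.cast_nonneg _) (le_max_left _ _) M) (by positivity) (by positivity))
  have h2 : (0 : ℝ) < max (T.size B : ℝ) 1 := by positivity
  have h3 : (0 : ℝ) < max k 1 := by positivity
  rw [hD, ← Real.logb_pow, ← Real.logb_mul h3.ne' (pow_pos h2 M).ne']
  exact Real.logb_le_logb_of_le one_lt_two (by exact_mod_cast hM) h1

/-- Without an ancilla, the change of the mutual information is controlled by the disturbance. -/
theorem abs_sub_lt_of_infoDisturbance_lt {A : C} {σ : 𝟙_ C ⟶ A} {f : A ⟶ A} {δ : ℝ}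
    (h : T.infoDisturbance σ f < ENNReal.ofReal δ) {ι κ : Type} [Fintype ι] [Fintype κ]
    {Ψ : ι → (𝟙_ C ⟶ A)} {a : κ → (A ⟶ 𝟙_ C)} (hΨ : T.IsTest Ψ)
    (hσ : ∑ i, T.state (Ψ i) = T.state σ) (ha : T.IsTest a) :
    (Real.logb 2 ((Fintype.card κ : ℝ) * (Fintype.card ι : ℝ) - 1))⁻¹ *
      |mutualInfo (T.joint Ψ a) - mutualInfo (T.joint (fun i => Ψ i ≫ f) a)| < δ := by
  -- The ancilla is the trivial system.
  have hdil : T.SumIsDilation (fun i => Ψ i ≫ (ρ_ A).inv) σ := by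
    refine ⟨𝟙 _, T.isTest_id _, ?_⟩
    simpa using hσ
  have hj : ∀ g : A ⟶ A, T.joint (fun i => (Ψ i ≫ (ρ_ A).inv) ≫ (g ▷ 𝟙_ C))
      (fun j => (ρ_ A).hom ≫ a j) = T.joint (fun i => Ψ i ≫ g) a := by
    intro g
    funext i j
    simp [joint]
  have hj' : T.joint (fun i => Ψ i ≫ (ρ_ A).inv) (fun j => (ρ_ A).hom ≫ a j) =
      T.joint Ψ a := by
    funext i j
    simp [joint]
  have hle : ENNReal.ofReal
      ((Real.logb 2 ((Fintype.card κ : ℝ) * (Fintype.card ι : ℝ) - 1))⁻¹ *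
        |mutualInfo (T.joint Ψ a) - mutualInfo (T.joint (fun i => Ψ i ≫ f) a)|) ≤
      T.infoDisturbance σ f := by
    rw [← hj f, ← hj']
    exact le_iSup_of_le (𝟙_ C) <| le_iSup_of_le ι <| le_iSup_of_le κ <|
      le_iSup_of_le inferInstance <| le_iSup_of_le inferInstance <|
      le_iSup_of_le _ <| le_iSup_of_le _ <|
      le_iSup_of_le (IsTest.comp_deterministic hΨ (T.isTest_rightUnitor_inv A)) <|
      le_iSup_of_le hdil <|
      le_iSup_of_le (IsDeterministic.comp_isTest (T.isTest_rightUnitor_hom A) ha) le_rfl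
  exact (ENNReal.ofReal_lt_ofReal_iff'.1 (hle.trans_lt h)).1

/-- The normalization grows at most linearly in N, so tolerance δ costs only O(δN) bits. For
products 0 and 1 the default logarithms at −1 and 0 vanish. -/
theorem logb_pow_mul_pow_sub_one_le (m n N : ℕ) :
    Real.logb 2 (((m ^ N : ℕ) : ℝ) * ((n ^ N : ℕ) : ℝ) - 1) ≤ N * Real.logb 2 (m * n) := by
  have hx : ((m ^ N : ℕ) : ℝ) * ((n ^ N : ℕ) : ℝ) = (((m * n) ^ N : ℕ) : ℝ) := by
    push_cast
    rw [mul_pow]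
  rw [hx, ← Real.logb_pow, ← Nat.cast_mul, ← Nat.cast_pow]
  generalize (m * n) ^ N = x
  match x with
  | 0 => simp
  | 1 => simp
  | x + 2 =>
    refine Real.logb_le_logb_of_le one_lt_two ?_ (by linarith)
    push_cast
    linarith [Nat.cast_nonneg (α := ℝ) x]

/-- A scheme with a small disturbance needs many copies of `B`. -/
theorem le_of_schemes_nonempty (hfin : T.FiniteDimensionalStates) {B A : C} {σ : 𝟙_ C ⟶ A}
    {c : ℝ} (hc : ∀ M : ℕ, 1 ≤ T.size (copies B M) →
      Real.logb 2 (T.size (copies B M)) ≤ c + M * Real.logb 2 (T.size B))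
    {ι κ : Type} [Fintype ι] [Fintype κ] {Ψ : ι → (𝟙_ C ⟶ A)} {a : κ → (A ⟶ 𝟙_ C)}
    (hΨ : T.IsTest Ψ) (hσ : ∑ i, T.state (Ψ i) = T.state σ) (ha : T.IsTest a) {N M : ℕ} {δ : ℝ}
    (hs : (T.schemes B σ N M δ).Nonempty) :
    N * mutualInfo (T.joint Ψ a) ≤ c + M * Real.logb 2 (T.size B) +
      δ * (N * Real.logb 2 (Fintype.card κ * Fintype.card ι)) := by
  obtain ⟨⟨E, F⟩, hE, hF, hlt⟩ := hs
  have hδ : 0 < δ := ENNReal.ofReal_pos.1 (bot_le.trans_lt hlt)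
  obtain ⟨ι', κ', _, _, Ψ', a', hΨ', hσ', ha', hι, hκ, hI⟩ := T.exists_copies_tests hΨ hσ ha N
  have hdist := T.abs_sub_lt_of_infoDisturbance_lt hlt hΨ' hσ' ha'
  have hlog := logb_pow_mul_pow_sub_one_le (Fintype.card κ) (Fintype.card ι) N
  rw [← hκ, ← hι] at hlog
  -- Absorbing the decoder into the observation exhibits the data as passing through `copies B M`.
  have hj : T.joint (fun i => Ψ' i ≫ E ≫ F) a' =
      T.joint (fun i => Ψ' i ≫ E) (fun j => F ≫ a' j) := by
    funext i j
    simp [joint]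
  dsimp only at hdist
  rw [hj] at hdist
  obtain ⟨hone, hthrough⟩ := T.mutualInfo_joint_le hfin (IsTest.comp_deterministic hΨ' hE)
    (IsDeterministic.comp_isTest hF ha')
  have hsize := hc M hone
  have hlog0 : 0 ≤ Real.logb 2 (T.size (copies B M) : ℝ) :=
    Real.logb_nonneg one_lt_two (by exact_mod_cast hone)
  rw [← hI]
  have hsum := T.sum_joint hΨ' ha'
  set l := Real.logb 2 ((Fintype.card κ' : ℝ) * (Fintype.card ι' : ℝ) - 1) with hl
  have hrank := rank_pos_of_sum_eq_one _ hsum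
  have hcκ : 1 ≤ Fintype.card κ' := hrank.trans_le (Matrix.rank_le_card_width _)
  have hcι : 1 ≤ Fintype.card ι' := hrank.trans_le (Matrix.rank_le_card_height _)
  -- With at most two outcome pairs the normalization is not positive and `hdist` is useless, but
  -- the joint matrix has rank 1 and carries no information.
  rcases Nat.lt_or_ge 2 (Fintype.card κ' * Fintype.card ι') with h | h
  · have hcard : (2 : ℝ) < (Fintype.card κ' : ℝ) * (Fintype.card ι' : ℝ) := by exact_mod_cast h
    have hl0 : 0 < l := Real.logb_pos one_lt_two (by linarith)
    rw [inv_mul_lt_iff₀ hl0] at hdist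
    have h1 := le_abs_self (mutualInfo (T.joint Ψ' a') -
      mutualInfo (T.joint (fun i => Ψ' i ≫ E) fun j => F ≫ a' j))
    have h2 := mul_le_mul_of_nonneg_left hlog hδ.le
    linarith
  · have hle : (Matrix.of (T.joint Ψ' a')).rank ≤ 1 := by
      have h1 := Matrix.rank_le_card_width (Matrix.of (T.joint Ψ' a'))
      have h2 := Matrix.rank_le_card_height (Matrix.of (T.joint Ψ' a'))
      nlinarith
    have h1 := mutualInfo_le_logb_rank _ (T.joint_nonneg Ψ' a') hsum
    rw [le_antisymm hle hrank, Nat.cast_one, Real.logb_one] at h1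
    have h2 : 0 ≤ (N : ℝ) * Real.logb 2 (Fintype.card κ * Fintype.card ι) := by
      rw [← Real.logb_pow, mul_pow, ← Nat.cast_pow, ← Nat.cast_pow, ← hκ, ← hι]
      exact Real.logb_nonneg one_lt_two (by exact_mod_cast Nat.mul_le_mul hcκ hcι)
    have h3 := mul_nonneg hδ.le h2
    linarith

/-- The hypothesis on `K` is written without division, so it also covers log₂ D_B = 0, where
positive information allows every `K`. -/
theorem le_classInfoContent (hfin : T.FiniteDimensionalStates) (hscaling : T.RegularScaling)
    {B A : C} {σ : 𝟙_ C ⟶ A} {ι κ : Type} [Fintype ι] [Fintype κ] {Ψ : ι → (𝟙_ C ⟶ A)}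
    {a : κ → (A ⟶ 𝟙_ C)} (hΨ : T.IsTest Ψ) (hσ : ∑ i, T.state (Ψ i) = T.state σ)
    (ha : T.IsTest a) {K : ℝ}
    (hK : K * Real.logb 2 (T.size B) < mutualInfo (T.joint Ψ a)) :
    ENNReal.ofReal K ≤ T.classInfoContent B σ := by
  obtain ⟨c, hc⟩ := T.exists_logb_size_copies_le hscaling B
  set I := mutualInfo (T.joint Ψ a) with hI
  set D := Real.logb 2 (T.size B : ℝ) with hD
  have hD0 : 0 ≤ D := by
    rw [hD]
    rcases Nat.eq_zero_or_pos (T.size B) with h | h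
    · simp [h]
    · exact Real.logb_nonneg one_lt_two (by exact_mod_cast h)
  set L := Real.logb 2 (Fintype.card κ * Fintype.card ι : ℝ) with hL
  have hδ : ∀ᶠ δ : ℝ in 𝓝[>] 0, K * D + δ * L < I := by
    refine Filter.Eventually.filter_mono nhdsWithin_le_nhds ?_
    have : Tendsto (fun δ : ℝ => K * D + δ * L) (𝓝 0) (𝓝 (K * D + 0 * L)) :=
      Continuous.tendsto (by fun_prop) 0
    rw [zero_mul, add_zero] at this
    exact this.eventually_lt_const hK
  refine ge_of_tendsto (T.tendsto_asympRatio B σ) (hδ.mono fun δ hlt => ?_)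
  have hN : ∀ᶠ N : ℕ in atTop, c < N * (I - K * D - δ * L) :=
    (tendsto_natCast_atTop_atTop.atTop_mul_const (by linarith)).eventually_gt_atTop c
  refine le_limsup_of_frequently_le ?_
  refine (hN.and (eventually_gt_atTop 0)).frequently.mono fun N hN => ?_
  obtain ⟨hN, hN0⟩ := hN
  have hN0' : (0 : ℝ) < N := by exact_mod_cast hN0
  rw [ratio, ENNReal.le_div_iff_mul_le (Or.inl (by exact_mod_cast hN0.ne'))
    (Or.inl (ENNReal.natCast_ne_top N))]
  refine le_iInf₂ fun M hM => ?_
  have h := T.le_of_schemes_nonempty hfin hc hΨ hσ ha hM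
  rw [← ENNReal.ofReal_natCast N, ← ENNReal.ofReal_natCast M,
    ← ENNReal.ofReal_mul' hN0'.le]
  refine ENNReal.ofReal_le_ofReal ?_
  -- If M < K·N, the scheme bound gives N·(I − K·D − δ·L) ≤ c, against the choice of N.
  by_contra hlt'
  push Not at hlt'
  have h2 : (M : ℝ) * D ≤ K * N * D := mul_le_mul_of_nonneg_right hlt'.le hD0
  rw [← hI, ← hD, ← hL] at h
  nlinarith

/-- The accessible information bounds the classical information content from below. -/
theorem accessibleInfo_div_le (hfin : T.FiniteDimensionalStates) (hscaling : T.RegularScaling)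
    (B : C) {A : C} (σ : 𝟙_ C ⟶ A) :
    T.accessibleInfo σ / ENNReal.ofReal (Real.logb 2 (T.size B : ℝ)) ≤
      T.classInfoContent B σ := by
  refine ENNReal.le_of_forall_nnreal_lt fun K hK => ?_
  have h := ENNReal.mul_lt_of_lt_div hK
  unfold accessibleInfo at h
  simp only [lt_iSup_iff] at h
  obtain ⟨ι, κ, _, _, Ψ, a, hΨ, hσ, ha, h⟩ := h
  rw [← ENNReal.ofReal_coe_nnreal, ← ENNReal.ofReal_mul K.coe_nonneg] at h
  rw [← ENNReal.ofReal_coe_nnreal]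
  exact T.le_classInfoContent hfin hscaling hΨ hσ ha (ENNReal.ofReal_lt_ofReal_iff'.1 h).1

end OPT

theorem mainTheorem6 {C : Type u} [Category.{v} C] [MonoidalCategory C] (T : OPT C)
    (hcausal : T.StronglyCausal) (hfin : T.FiniteDimensionalStates) (hscaling : T.RegularScaling)
    (B : C) (hB : T.IsObit B) (A : C) (ρ : 𝟙_ C ⟶ A) (hρ : T.IsDeterministic ρ) :
    T.accessibleInfo ρ / ENNReal.ofReal (Real.logb 2 (T.size B : ℝ)) ≤ T.classInfoContent B ρ ∧
      (T.IsMixed ρ → 0 < T.classInfoContent B ρ) := by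
  have h := T.accessibleInfo_div_le hfin hscaling B ρ
  refine ⟨h, fun hmix => lt_of_lt_of_le ?_ h⟩
  exact ENNReal.div_pos (T.accessibleInfo_pos hcausal hρ hmix).ne' ENNReal.ofReal_ne_top
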